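/- Let $\mathbb{H}=\{w\in\mathbb{C} : \operatorname{Im} w>0\}$ be the upper half plane and let $n\ge 1$. Suppose $f:\mathbb{H}^n\to\mathbb{H}$ is holomorphic and satisfies $f(\lambda,\ldots,\lambda)=\lambda$ for all $\lambda\in\mathbb{H}$. Suppose in addition that there is a real number $T>0$ such that $$f(z_1+T,\ldots,z_n+T)=f(z_1,\ldots,z_n)+T\qquad\text{for all }(z_1,\ldots,z_n)\in\mathbb{H}^n.$$ Then $$f(z_1,\ldots,z_n)=\sum_{j=1}^n\alpha_j z_j\qquad\text{for all }(z_1,\ldots,z_n)\in\mathbb{H}^n,$$ where $\alpha_j=\dfrac{\partial f}{\partial z_j}(i,\ldots,i)$ for $j=1,\ldots,n$. -/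

import Mathlib

/-- The product `ℍⁿ` of `n` copies of the open upper half plane, as a subset of `ℂⁿ`. -/
def upperHalfPlanePow (n : ℕ) : Set (Fin n → ℂ) :=
  {z | ∀ j, 0 < (z j).im}

/-- The complex partial derivative `∂f/∂z_j` at the point `a`: the derivative of `f` in its `j`-th
variable, the other variables being held fixed. -/
noncomputable def complexPartialDeriv {n : ℕ} (f : (Fin n → ℂ) → ℂ) (j : Fin n)
    (a : Fin n → ℂ) : ℂ :=
  deriv (fun w : ℂ => f (Function.update a j w)) (a j)

open Complex Filter Topology Metric Set
open scoped ComplexConjugate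

/-! By Schwarz–Pick, `f` sends a product of equal hyperbolic discs centred on the diagonal into that
disc. Letting the centre tend to infinity or to 0 gives bounds on horoballs
(`le_im_of_forall_le_im`, `im_le_of_im_eq_of_abs_re_le`). For real `x`, they make `P w = f (x + w) -
w` a `T`-periodic function with `Im P ≥ 0` and `Im P → 0` up the imaginary axis. Then `exp (iP)`
extends over the cusp and attains its maximum modulus there, so `P` is a real constant `c x`. The
derivative of `f` along `x` at `yi` is thus independent of `y`, while a rescaled Schwarz lemma puts
it within `O(1/y)` of `c x`; hence `c` is linear. The identity theorem on a complex line carries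
this to all of `ℍⁿ`. -/

/-- The inverse Cayley transform based at `τ` maps the unit disc into the upper half plane. -/
lemma im_inverse_cayley_pos {τ s : ℂ} (hτ : 0 < τ.im) (hs : ‖s‖ < 1) :
    0 < ((τ - conj τ * s) / (1 - s)).im := by
  have h1 : 1 - s ≠ 0 := by
    intro h
    rw [← sub_eq_zero.mp h] at hs
    simp at hs
  have h2 : 0 < normSq (1 - s) := normSq_pos.mpr h1
  have h3 : normSq s < 1 := by
    rw [normSq_eq_norm_sq]
    nlinarith [norm_nonneg s]
  have h4 : ((τ - conj τ * s) / (1 - s)).im = τ.im * (1 - normSq s) / normSq (1 - s) := by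
    rw [div_im]
    field_simp
    simp [normSq_apply]
    ring
  rw [h4]
  exact div_pos (mul_pos hτ (by linarith)) h2

lemma inverse_cayley_cayley {τ z : ℂ} (hτ : 0 < τ.im) (hz : 0 < z.im) :
    (τ - conj τ * ((z - τ) / (z - conj τ))) / (1 - (z - τ) / (z - conj τ)) = z := by
  have h1 : z - conj τ ≠ 0 := by
    intro h
    have := congrArg im h
    simp at this
    linarith
  have h2 : τ - conj τ ≠ 0 := by
    intro h
    have := congrArg im h
    simp at this
    linarith
  have h3 : 1 - (z - τ) / (z - conj τ) = (τ - conj τ) / (z - conj τ) := by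
    field_simp
    ring
  rw [h3]
  field_simp
  ring

lemma normSq_sub_conj (z τ : ℂ) :
    normSq (z - conj τ) = normSq (z - τ) + 4 * z.im * τ.im := by
  simp [normSq_apply]
  ring

/-- This form of a hyperbolic disc survives as its centre tends to the boundary. -/
lemma norm_sub_le_mul_norm_sub_conj_iff {M : ℝ} {z τ : ℂ} (hM : 0 < M) (hτ : 0 < τ.im) :
    ‖z - τ‖ ≤ √(M / (M + 4 * τ.im)) * ‖z - conj τ‖ ↔ normSq (z - τ) ≤ M * z.im := by
  have hN : 0 < M + 4 * τ.im := by positivity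
  rw [← sq_le_sq₀ (norm_nonneg _) (by positivity), mul_pow, Real.sq_sqrt (by positivity),
    ← normSq_eq_norm_sq, ← normSq_eq_norm_sq, normSq_sub_conj, div_mul_eq_mul_div,
    le_div_iff₀ hN]
  constructor <;> intro h <;> nlinarith

/-! ### Schwarz–Pick and horoball estimates -/

section

variable {n : ℕ} {f : (Fin n → ℂ) → ℂ}

/-- A **Schwarz–Pick lemma**: a holomorphic map `ℍⁿ → ℍ` which is the identity on the diagonal
sends points of a hyperbolic disc to that disc. -/
lemma normSq_sub_le_of_forall_normSq_sub_le
    (hol : DifferentiableOn ℂ f (upperHalfPlanePow n))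
    (maps : ∀ z ∈ upperHalfPlanePow n, 0 < (f z).im)
    (diag : ∀ w : ℂ, 0 < w.im → f (fun _ => w) = w)
    {z : Fin n → ℂ} (hz : z ∈ upperHalfPlanePow n) {τ : ℂ} (hτ : 0 < τ.im) {M : ℝ} (hM : 0 < M)
    (h : ∀ j, normSq (z j - τ) ≤ M * (z j).im) : normSq (f z - τ) ≤ M * (f z).im := by
  set ρ := √(M / (M + 4 * τ.im)) with hρ
  have hρ0 : 0 < ρ := by positivity
  have hρ1 : ρ < 1 := by
    rw [hρ, Real.sqrt_lt' one_pos, div_lt_iff₀ (by positivity)]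
    linarith
  rw [← norm_sub_le_mul_norm_sub_conj_iff hM hτ, ← hρ]
  have hne : ∀ w : ℂ, 0 < w.im → w - conj τ ≠ 0 := by
    intro w hw h
    have := congrArg im h
    simp at this
    linarith
  -- Dividing by `ρ` gives an analytic disc `Z` with `Z 0 = (τ, …, τ)` and `Z ρ = z`, to which the
  -- one-variable Schwarz lemma applies.
  set a : Fin n → ℂ := fun j => (z j - τ) / (z j - conj τ) / ρ with ha
  have ha1 : ∀ j, ‖a j‖ ≤ 1 := by
    intro j
    have h1 := (norm_sub_le_mul_norm_sub_conj_iff hM hτ).mpr (h j)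
    have h2 : 0 < ‖z j - conj τ‖ := norm_pos_iff.mpr (hne _ (hz j))
    rw [ha]
    simp only [norm_div, norm_real, Real.norm_of_nonneg hρ0.le]
    rw [div_div, div_le_one (by positivity)]
    linarith
  have hsa : ∀ s ∈ ball (0 : ℂ) 1, ∀ j, ‖s * a j‖ < 1 := by
    intro s hs j
    rw [mem_ball_zero_iff] at hs
    rw [norm_mul]
    exact (mul_le_of_le_one_right (norm_nonneg _) (ha1 j)).trans_lt hs
  set Z : ℂ → Fin n → ℂ := fun s j => (τ - conj τ * (s * a j)) / (1 - s * a j) with hZ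
  have hZm : MapsTo Z (ball 0 1) (upperHalfPlanePow n) :=
    fun s hs j => im_inverse_cayley_pos hτ (hsa s hs j)
  have hZd : DifferentiableOn ℂ Z (ball 0 1) := by
    rw [differentiableOn_pi]
    intro j s hs
    refine DifferentiableAt.differentiableWithinAt (DifferentiableAt.div (by fun_prop)
      (by fun_prop) ?_)
    intro h0
    have h1 := hsa s hs j
    rw [← sub_eq_zero.mp h0] at h1
    simp at h1
  have hfZ : DifferentiableOn ℂ (fun s => f (Z s)) (ball 0 1) := hol.comp hZd hZm
  set φ : ℂ → ℂ := fun s => (f (Z s) - τ) / (f (Z s) - conj τ) with hφ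
  have hφd : DifferentiableOn ℂ φ (ball 0 1) :=
    (hfZ.sub_const _).div (hfZ.sub_const _) fun s hs => hne _ (maps _ (hZm hs))
  have hφm : MapsTo φ (ball 0 1) (closedBall 0 1) := by
    intro s hs
    have hi := maps _ (hZm hs)
    rw [mem_closedBall_zero_iff, hφ]
    simp only [norm_div]
    rw [div_le_one (norm_pos_iff.mpr (hne _ hi)), ← sq_le_sq₀ (norm_nonneg _) (norm_nonneg _),
      ← normSq_eq_norm_sq, ← normSq_eq_norm_sq, normSq_sub_conj]
    have := mul_pos hi hτ
    linarith
  have hφ0 : φ 0 = 0 := by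
    have : Z 0 = fun _ => τ := by
      ext j
      simp [hZ]
    simp [hφ, this, diag τ hτ]
  have hZρ : Z ρ = z := by
    ext j
    have : (ρ : ℂ) * a j = (z j - τ) / (z j - conj τ) := by
      rw [ha]
      have : (ρ : ℂ) ≠ 0 := by exact_mod_cast hρ0.ne'
      field_simp
    simp only [hZ, this]
    exact inverse_cayley_cayley hτ (hz j)
  have hn : ‖(ρ : ℂ)‖ = ρ := by rw [norm_real, Real.norm_of_nonneg hρ0.le]
  have key := norm_le_norm_of_mapsTo_ball (z := (ρ : ℂ)) hφd hφm hφ0 (by rwa [hn])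
  simp only [hφ, hZρ, norm_div, hn] at key
  rwa [div_le_iff₀ (norm_pos_iff.mpr (hne _ (maps _ hz)))] at key

/-- Discs centred at `ti` approximate a horoball at infinity. If `v < m`, they give `t² (m - v) ≤ B
v`, false for large `t`. -/
lemma le_im_of_forall_le_im
    (hol : DifferentiableOn ℂ f (upperHalfPlanePow n))
    (maps : ∀ z ∈ upperHalfPlanePow n, 0 < (f z).im)
    (diag : ∀ w : ℂ, 0 < w.im → f (fun _ => w) = w)
    {z : Fin n → ℂ} {m : ℝ} (hm : 0 < m) (h : ∀ j, m ≤ (z j).im) : m ≤ (f z).im := by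
  have hz : z ∈ upperHalfPlanePow n := fun j => hm.trans_le (h j)
  by_contra! hlt
  set v := (f z).im with hv
  have hv0 : 0 < v := maps z hz
  set B := ∑ j, normSq (z j) with hB
  have hB0 : 0 ≤ B := Finset.sum_nonneg fun j _ => normSq_nonneg _
  have hBj : ∀ j, normSq (z j) ≤ B := fun j =>
    Finset.single_le_sum (f := fun j => normSq (z j)) (fun j _ => normSq_nonneg _)
      (Finset.mem_univ j)
  -- The term `2 * m + 1` makes the disc parameter positive and `t ≥ 1`; the rest forces `B v < t (m
  -- - v)`.
  set t := 2 * m + 1 + B * v / (m - v) with ht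
  have hmv : 0 < m - v := by linarith
  have hq : 0 ≤ B * v / (m - v) := by positivity
  have ht1 : 2 * m + 1 ≤ t := by linarith
  have ht0 : 0 < t := by linarith
  have ht2 : B * v < t * (m - v) := by
    have : B * v = B * v / (m - v) * (m - v) := by field_simp
    nlinarith
  have hexp : ∀ w : ℂ, normSq (w - t * I) = normSq w - 2 * t * w.im + t ^ 2 := by
    intro w
    simp [normSq_apply]
    ring
  have hM : 0 < (B + t ^ 2) / m - 2 * t := by
    rw [sub_pos, lt_div_iff₀ hm]
    nlinarith
  have key := normSq_sub_le_of_forall_normSq_sub_le hol maps diag hz (τ := t * I)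
    (by simpa using ht0) hM (fun j => by
      rw [hexp, sub_mul, div_mul_eq_mul_div]
      have : B + t ^ 2 ≤ (B + t ^ 2) * (z j).im / m := by
        rw [le_div_iff₀ hm]
        exact mul_le_mul_of_nonneg_left (h j) (by positivity)
      linarith [hBj j])
  rw [hexp, ← hv, sub_mul, div_mul_eq_mul_div] at key
  have h1 : t ^ 2 ≤ (B + t ^ 2) * v / m := by linarith [normSq_nonneg (f z)]
  rw [le_div_iff₀ hm] at h1
  have h2 : t * (m - v) ≤ t ^ 2 * (m - v) := by
    gcongr
    nlinarith
  linarith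

/-- Discs centred at `εi` tend, as `ε → 0`, to a horoball tangent to the real axis at 0. -/
lemma im_le_of_im_eq_of_abs_re_le
    (hol : DifferentiableOn ℂ f (upperHalfPlanePow n))
    (maps : ∀ z ∈ upperHalfPlanePow n, 0 < (f z).im)
    (diag : ∀ w : ℂ, 0 < w.im → f (fun _ => w) = w)
    {z : Fin n → ℂ} {y R : ℝ} (hy : 0 < y) (him : ∀ j, (z j).im = y) (hre : ∀ j, |(z j).re| ≤ R) :
    (f z).im ≤ y + R ^ 2 / y := by
  have hz : z ∈ upperHalfPlanePow n := fun j => by rw [him j]; exact hy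
  set v := (f z).im with hv
  have hv0 : 0 < v := maps z hz
  have key : ∀ ε ∈ Ioo 0 y, (v - ε) ^ 2 ≤ (R ^ 2 + (y - ε) ^ 2) / y * v := by
    rintro ε ⟨h0, h1⟩
    have hexp : ∀ w : ℂ, normSq (w - ε * I) = w.re ^ 2 + (w.im - ε) ^ 2 := by
      intro w
      simp [normSq_apply]
      ring
    have hp : 0 < (y - ε) ^ 2 := by
      have : 0 < y - ε := by linarith
      positivity
    have := normSq_sub_le_of_forall_normSq_sub_le hol maps diag hz (τ := ε * I)
      (by simpa using h0) (M := (R ^ 2 + (y - ε) ^ 2) / y) (by positivity) (fun j => by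
        rw [hexp, him j, div_mul_cancel₀ _ hy.ne']
        have := sq_le_sq' (neg_le_of_abs_le (hre j)) (le_of_abs_le (hre j))
        linarith)
    rw [hexp] at this
    nlinarith [sq_nonneg (f z).re]
  have hlim : (v - 0) ^ 2 ≤ (R ^ 2 + (y - 0) ^ 2) / y * v := by
    have hl : Tendsto (fun ε : ℝ => (v - ε) ^ 2) (𝓝[>] 0) (𝓝 ((v - 0) ^ 2)) :=
      ((by fun_prop : Continuous fun ε : ℝ => (v - ε) ^ 2).tendsto 0).mono_left nhdsWithin_le_nhds
    have hr : Tendsto (fun ε : ℝ => (R ^ 2 + (y - ε) ^ 2) / y * v) (𝓝[>] 0)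
        (𝓝 ((R ^ 2 + (y - 0) ^ 2) / y * v)) :=
      ((by fun_prop : Continuous fun ε : ℝ => (R ^ 2 + (y - ε) ^ 2) / y * v).tendsto 0).mono_left
        nhdsWithin_le_nhds
    exact le_of_tendsto_of_tendsto hl hr
      (eventually_of_mem (Ioo_mem_nhdsGT hy) key)
  have h1 : v * v ≤ (R ^ 2 + y ^ 2) / y * v := by simpa [sq] using hlim
  have h2 := le_of_mul_le_mul_right h1 hv0
  calc v ≤ (R ^ 2 + y ^ 2) / y := h2
    _ = y + R ^ 2 / y := by field_simp; ring

lemma norm_sub_le_of_forall_norm_sub_le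
    (hol : DifferentiableOn ℂ f (upperHalfPlanePow n))
    (maps : ∀ z ∈ upperHalfPlanePow n, 0 < (f z).im)
    (diag : ∀ w : ℂ, 0 < w.im → f (fun _ => w) = w)
    {z : Fin n → ℂ} {y r : ℝ} (hr : 0 < r) (hry : r ≤ y / 2) (h : ∀ j, ‖z j - y * I‖ ≤ r) :
    ‖f z - y * I‖ ≤ 2 * r := by
  have hy : 0 < y := by linarith
  have him : ∀ j, y / 2 ≤ (z j).im := by
    intro j
    have h1 := (abs_le.mp ((abs_im_le_norm _).trans (h j))).1
    simp at h1
    linarith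
  have hz : z ∈ upperHalfPlanePow n := fun j => (by linarith : 0 < y / 2).trans_le (him j)
  have key := normSq_sub_le_of_forall_normSq_sub_le hol maps diag hz (τ := y * I)
    (by simpa using hy) (M := 2 * r ^ 2 / y) (by positivity) (fun j => by
      rw [normSq_eq_norm_sq]
      calc ‖z j - y * I‖ ^ 2 ≤ r ^ 2 := by gcongr; exact h j
        _ = 2 * r ^ 2 / y * (y / 2) := by field_simp
        _ ≤ _ := by gcongr; exact him j)
  set D := ‖f z - y * I‖ with hD
  have hD0 : 0 ≤ D := norm_nonneg _
  have h1 : (f z).im ≤ D + y := by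
    have h1 := (abs_le.mp (abs_im_le_norm (f z - y * I))).2
    simp at h1
    linarith
  rw [normSq_eq_norm_sq, ← hD] at key
  have h2 : D ^ 2 ≤ r * D + 2 * r ^ 2 := by
    calc D ^ 2 ≤ 2 * r ^ 2 / y * (D + y) := key.trans (by gcongr)
      _ = r * (r / (y / 2)) * D + 2 * r ^ 2 := by field_simp
      _ ≤ r * 1 * D + 2 * r ^ 2 := by
        gcongr
        rw [div_le_one (by linarith)]
        exact hry
      _ = _ := by ring
  -- The quadratic inequality factors as `(D - 2r)(D + r) ≤ 0`.
  nlinarith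

end

/-! ### Maximum principle at the cusp -/

lemma isPreconnected_setOf_im_pos : IsPreconnected {w : ℂ | 0 < w.im} :=
  (convex_halfSpace_im_gt 0).isPreconnected

/-- A periodic holomorphic function on the upper half plane with nonnegative imaginary part tending
to zero along the imaginary axis is constant, by the maximum principle at the cusp. -/
lemma eq_of_periodic_of_im_nonneg_of_tendsto {P : ℂ → ℂ} {T : ℝ} (hT : 0 < T)
    (hP : DifferentiableOn ℂ P {w | 0 < w.im})
    (hper : ∀ w : ℂ, 0 < w.im → P (w + T) = P w)
    (hnn : ∀ w : ℂ, 0 < w.im → 0 ≤ (P w).im)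
    (hlim : Tendsto (fun y : ℝ => (P (y * I)).im) atTop (𝓝 0))
    {w₁ w₂ : ℂ} (h₁ : 0 < w₁.im) (h₂ : 0 < w₂.im) : P w₁ = P w₂ := by
  have hopen : IsOpen {w : ℂ | 0 < w.im} := isOpen_lt continuous_const continuous_im
  have hconn := isPreconnected_setOf_im_pos
  -- The value 0 off the half plane makes `Q` periodic and bounded on all of `ℂ`.
  set Q : ℂ → ℂ := fun w => if 0 < w.im then exp (I * P w) else 0 with hQ
  have hQe : ∀ w : ℂ, 0 < w.im → Q w = exp (I * P w) := fun w hw => if_pos hw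
  have hQper : Function.Periodic Q T := by
    intro w
    have : (w + T).im = w.im := by simp
    by_cases hw : 0 < w.im
    · rw [hQe _ (by rwa [this]), hQe _ hw, hper w hw]
    · simp [hQ, hw]
  have hnorm : ∀ w : ℂ, 0 < w.im → ‖Q w‖ = Real.exp (-(P w).im) := by
    intro w hw
    rw [hQe w hw, norm_exp]
    simp
  have hQle : ∀ w, ‖Q w‖ ≤ 1 := by
    intro w
    by_cases hw : 0 < w.im
    · rw [hnorm w hw, Real.exp_le_one_iff]
      linarith [hnn w hw]
    · simp [hQ, hw]
  have hQd : DifferentiableOn ℂ Q {w | 0 < w.im} :=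
    ((hP.const_mul I).cexp).congr fun w hw => hQe w hw
  have hQat : ∀ w : ℂ, 0 < w.im → DifferentiableAt ℂ Q w := fun w hw =>
    hQd.differentiableAt (hopen.mem_nhds hw)
  have hev : ∀ᶠ w in comap im atTop, DifferentiableAt ℂ Q w :=
    ((eventually_gt_atTop (0 : ℝ)).comap im).mono fun w hw => hQat w hw
  have hbd : BoundedAtFilter (comap im atTop) Q :=
    Asymptotics.IsBigO.of_bound 1 (Eventually.of_forall fun w => by simpa using hQle w)
  set G := Function.Periodic.cuspFunction T Q with hG
  have hG0 : DifferentiableAt ℂ G 0 :=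
    Function.Periodic.differentiableAt_cuspFunction_zero hT hQper hev hbd
  have hinv : ∀ q ∈ ball (0 : ℂ) 1, q ≠ 0 → 0 < (Function.Periodic.invQParam T q).im := by
    intro q hq hq0
    rw [mem_ball_zero_iff] at hq
    rw [Function.Periodic.im_invQParam]
    have := Real.log_neg (norm_pos_iff.mpr hq0) hq
    rw [neg_div]
    exact mul_pos_of_neg_of_neg (neg_neg_of_pos (by positivity)) this
  have hGd : DifferentiableOn ℂ G (ball 0 1) := by
    intro q hq
    refine DifferentiableAt.differentiableWithinAt ?_
    rcases eq_or_ne q 0 with rfl | hq0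
    · exact hG0
    · rw [← Function.Periodic.qParam_right_inv hT.ne' hq0]
      exact Function.Periodic.differentiableAt_cuspFunction hT.ne' hQper (hQat _ (hinv q hq hq0))
  have hGlim : ‖G 0‖ = 1 := by
    have ht := Function.Periodic.tendsto_at_I_inf hT hQper hev hbd
    have hI : Tendsto (fun y : ℝ => (y : ℂ) * I) atTop (comap im atTop) := by
      rw [tendsto_comap_iff]
      exact tendsto_id.congr fun y => by simp
    have h3 := (ht.comp hI).norm
    have h4 : Tendsto (fun y : ℝ => Real.exp (-(P (y * I)).im)) atTop (𝓝 1) := by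
      simpa using hlim.neg.rexp
    refine tendsto_nhds_unique h3 (h4.congr' ?_)
    filter_upwards [eventually_gt_atTop 0] with y hy
    exact (hnorm _ (by simpa using hy)).symm
  have hmax : IsMaxOn (norm ∘ G) (ball 0 1) 0 := by
    intro q hq
    simp only [Function.comp_apply, mem_ofPred_eq, hGlim]
    rcases eq_or_ne q 0 with rfl | hq0
    · exact hGlim.le
    · rw [hG, Function.Periodic.cuspFunction_eq_of_nonzero _ _ hq0]
      exact hQle _
  have hconst := Complex.eqOn_of_isPreconnected_of_isMaxOn_norm
    (convex_ball (0 : ℂ) 1).isPreconnected isOpen_ball hGd (mem_ball_self one_pos) hmax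
  have hQc : ∀ w : ℂ, 0 < w.im → Q w = G 0 := by
    intro w hw
    rw [← Function.Periodic.eq_cuspFunction hT.ne' hQper w]
    exact hconst (mem_ball_zero_iff.mpr (Function.Periodic.norm_qParam_lt_one hT hw))
  -- Differentiating the constant `exp (iP)` gives `P' = 0` without choosing a logarithm.
  refine hopen.is_const_of_deriv_eq_zero hconn hP (fun w hw => ?_) h₁ h₂
  have hPw := (hP.differentiableAt (hopen.mem_nhds hw)).hasDerivAt
  have hd := (hPw.const_mul I).cexp
  have hd0 : HasDerivAt (fun w => exp (I * P w)) 0 w := by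
    refine (hasDerivAt_const w (G 0)).congr_of_eventuallyEq ?_
    filter_upwards [hopen.mem_nhds hw] with u hu
    rw [← hQe u hu, hQc u hu]
  have := hd.unique hd0
  simpa [exp_ne_zero, I_ne_zero] using this

/-! ### Real translates of the diagonal -/

section

variable {n : ℕ} {f : (Fin n → ℂ) → ℂ}

/-- On each real translate of the diagonal, `f` is a real translation. -/
lemma exists_forall_eq_add_real
    (hol : DifferentiableOn ℂ f (upperHalfPlanePow n))
    (maps : ∀ z ∈ upperHalfPlanePow n, 0 < (f z).im)
    (diag : ∀ w : ℂ, 0 < w.im → f (fun _ => w) = w)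
    {T : ℝ} (hT : 0 < T)
    (periodic : ∀ z ∈ upperHalfPlanePow n, f (fun j => z j + (T : ℂ)) = f z + (T : ℂ))
    (x : Fin n → ℝ) : ∃ c : ℝ, ∀ w : ℂ, 0 < w.im → f (fun j => x j + w) = w + c := by
  have hmem : ∀ w : ℂ, 0 < w.im → (fun j => (x j : ℂ) + w) ∈ upperHalfPlanePow n := by
    intro w hw j
    simpa using hw
  set P : ℂ → ℂ := fun w => f (fun j => x j + w) - w with hP
  have hPd : DifferentiableOn ℂ P {w | 0 < w.im} :=
    (hol.comp (by fun_prop) hmem).sub differentiableOn_id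
  have hPper : ∀ w : ℂ, 0 < w.im → P (w + T) = P w := by
    intro w hw
    have := periodic _ (hmem w hw)
    simp only [hP, ← add_assoc, this]
    ring
  have hPnn : ∀ w : ℂ, 0 < w.im → 0 ≤ (P w).im := by
    intro w hw
    have := le_im_of_forall_le_im hol maps diag hw (z := fun j => x j + w) (fun j => by simp)
    simpa [hP] using this
  have hPlim : Tendsto (fun y : ℝ => (P (y * I)).im) atTop (𝓝 0) := by
    set R := ∑ j, |x j| with hR
    have hR' : Tendsto (fun y : ℝ => R ^ 2 / y) atTop (𝓝 0) :=
      tendsto_const_nhds.div_atTop tendsto_id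
    refine tendsto_of_tendsto_of_tendsto_of_le_of_le' tendsto_const_nhds hR' ?_ ?_
    · filter_upwards [eventually_gt_atTop 0] with y hy
      exact hPnn _ (by simpa using hy)
    · filter_upwards [eventually_gt_atTop 0] with y hy
      have := im_le_of_im_eq_of_abs_re_le hol maps diag hy (z := fun j => x j + y * I) (R := R)
        (fun j => by simp) (fun j => by
          simpa using Finset.single_le_sum (f := fun j => |x j|) (fun j _ => abs_nonneg _)
            (Finset.mem_univ j))
      simp only [hP, sub_im, mul_im, ofReal_re, I_im, ofReal_im, I_re]
      linarith
  have hconst : ∀ w : ℂ, 0 < w.im → P w = P I := fun w hw =>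
    eq_of_periodic_of_im_nonneg_of_tendsto hT hPd hPper hPnn hPlim hw (by simp)
  have him : (P I).im = 0 := by
    refine tendsto_nhds_unique (tendsto_const_nhds.congr' ?_) hPlim
    filter_upwards [eventually_gt_atTop 0] with y hy
    rw [hconst (y * I) (by simpa using hy)]
  refine ⟨(P I).re, fun w hw => ?_⟩
  have hre : ((P I).re : ℂ) = P I := Complex.ext (by simp) (by simp [him])
  rw [hre, ← hconst w hw]
  simp [hP]

end

/-! ### Linearity in the translation -/

section

variable {n : ℕ} {f : (Fin n → ℂ) → ℂ}

lemma isOpen_upperHalfPlanePow (n : ℕ) : IsOpen (upperHalfPlanePow n) := by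
  have : upperHalfPlanePow n = ⋂ j, {z | 0 < (z j).im} := by
    ext z
    simp [upperHalfPlanePow]
  rw [this]
  exact isOpen_iInter_of_finite fun j =>
    isOpen_lt continuous_const (continuous_im.comp (continuous_apply j))

lemma complexPartialDeriv_eq_fderiv {a : Fin n → ℂ} (hf : DifferentiableAt ℂ f a) (j : Fin n) :
    complexPartialDeriv f j a = fderiv ℂ f a (Pi.single j 1) := by
  have h1 : HasFDerivAt f (fderiv ℂ f a) (Function.update a j (a j)) := by
    rw [Function.update_eq_self]
    exact hf.hasFDerivAt
  exact (h1.comp_hasDerivAt (a j) (hasDerivAt_update a j (a j))).deriv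

lemma fderiv_apply_eq_sum_complexPartialDeriv {a : Fin n → ℂ} (hf : DifferentiableAt ℂ f a)
    (v : Fin n → ℂ) : fderiv ℂ f a v = ∑ j, complexPartialDeriv f j a * v j := by
  conv_lhs => rw [pi_eq_sum_univ' v, map_sum]
  refine Finset.sum_congr rfl fun j _ => ?_
  rw [complexPartialDeriv_eq_fderiv hf, map_smul, smul_eq_mul, mul_comm]

lemma smul_add_mul_I_mem {x : Fin n → ℝ} {R y : ℝ} (hR : 0 < R) (hx : ∀ j, |x j| ≤ R)
    {s : ℂ} (hs : ‖s‖ < y / (2 * R)) :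
    (∀ j, ‖s * x j + y * I - y * I‖ ≤ ‖s‖ * R) ∧ ‖s‖ * R ≤ y / 2 ∧
      (fun j => s * x j + y * I) ∈ upperHalfPlanePow n := by
  have h1 : ∀ j, ‖s * x j‖ ≤ ‖s‖ * R := fun j => by
    rw [norm_mul, norm_real, Real.norm_eq_abs]
    gcongr
    exact hx j
  have h2 : ‖s‖ * R < y / 2 := by
    calc ‖s‖ * R < y / (2 * R) * R := by gcongr
      _ = y / 2 := by field_simp
  refine ⟨fun j => by simpa using h1 j, h2.le, fun j => ?_⟩
  have h3 := (abs_le.mp ((abs_im_le_norm _).trans (h1 j))).1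
  have h4 : 0 ≤ ‖s‖ * R := by positivity
  have h5 : (s * x j + y * I).im = (s * x j).im + y := by simp
  rw [h5]
  linarith

/-- The rescaled Schwarz lemma: the deviation of `f` from its linear part along a real direction
decays at large height. -/
lemma norm_sub_deriv_le
    (hol : DifferentiableOn ℂ f (upperHalfPlanePow n))
    (maps : ∀ z ∈ upperHalfPlanePow n, 0 < (f z).im)
    (diag : ∀ w : ℂ, 0 < w.im → f (fun _ => w) = w)
    {x : Fin n → ℝ} {R y : ℝ} (hR : 0 < R) (hx : ∀ j, |x j| ≤ R) (hy : 2 * R < y) :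
    ‖f (fun j => x j + y * I) - y * I - deriv (fun s : ℂ => f (fun j => s * x j + y * I)) 0‖
      ≤ 8 * R ^ 2 / y := by
  have hy0 : 0 < y := by linarith
  set ρ := y / (2 * R) with hρ
  have hρ0 : 0 < ρ := by positivity
  have hρ1 : 1 < ρ := by rwa [hρ, one_lt_div (by positivity)]
  set h : ℂ → ℂ := fun s => f (fun j => s * x j + y * I) with hh
  have hm : ∀ s ∈ ball (0 : ℂ) ρ, ‖s‖ < y / (2 * R) := fun s hs => by
    rwa [mem_ball_zero_iff] at hs
  have hd : DifferentiableOn ℂ h (ball 0 ρ) :=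
    hol.comp (by fun_prop) fun s hs => (smul_add_mul_I_mem hR hx (hm s hs)).2.2
  have h0 : h 0 = y * I := by
    simpa [hh] using diag (y * I) (by simpa using hy0)
  have hmaps : MapsTo h (ball 0 ρ) (closedBall (h 0) y) := by
    intro s hs
    rw [mem_closedBall, dist_eq_norm, h0]
    obtain ⟨h1, h2, -⟩ := smul_add_mul_I_mem hR hx (hm s hs)
    have := norm_sub_le_of_forall_norm_sub_le hol maps diag (z := fun j => s * x j + y * I)
      (r := y / 2) (by positivity) le_rfl (fun j => (h1 j).trans h2)
    linarith
  -- `k 1` is the increment of `f` and `k 0` the derivative. As `‖k‖ ≤ 2R`, a second Schwarz lemma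
  -- bounds their distance by `4R / ρ`.
  set k := dslope h 0 with hk
  have hkle : ∀ s ∈ ball (0 : ℂ) ρ, ‖k s‖ ≤ 2 * R := fun s hs => by
    have := norm_dslope_le_div_of_mapsTo_ball hd hmaps hs
    have e : y / ρ = 2 * R := by
      rw [hρ]
      field_simp
    rwa [e] at this
  have hkd : DifferentiableOn ℂ k (ball 0 ρ) :=
    (differentiableOn_dslope (ball_mem_nhds 0 hρ0)).mpr hd
  have hkm : MapsTo k (ball 0 ρ) (closedBall (k 0) (4 * R)) := by
    intro s hs
    rw [mem_closedBall, dist_eq_norm]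
    have := norm_sub_le (k s) (k 0)
    linarith [hkle s hs, hkle 0 (mem_ball_self hρ0)]
  have key := dist_le_div_mul_dist_of_mapsTo_ball (z := 1) hkd hkm (by simpa using hρ1)
  have hk1 : k 1 = f (fun j => x j + y * I) - y * I := by
    rw [hk, dslope_of_ne _ one_ne_zero, slope_def_field, h0]
    simp [hh]
  rw [dist_eq_norm, hk1, hk, dslope_same] at key
  refine key.trans (le_of_eq ?_)
  simp only [dist_zero_right, norm_one, hρ]
  field_simp
  ring

/-- `f` agrees with its linear part on real translates of the diagonal. -/
lemma eq_add_sum_complexPartialDeriv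
    (hol : DifferentiableOn ℂ f (upperHalfPlanePow n))
    (maps : ∀ z ∈ upperHalfPlanePow n, 0 < (f z).im)
    (diag : ∀ w : ℂ, 0 < w.im → f (fun _ => w) = w)
    {T : ℝ} (hT : 0 < T)
    (periodic : ∀ z ∈ upperHalfPlanePow n, f (fun j => z j + (T : ℂ)) = f z + (T : ℂ))
    (x : Fin n → ℝ) {w : ℂ} (hw : 0 < w.im) :
    f (fun j => x j + w) = w + ∑ j, complexPartialDeriv f j (fun _ => I) * x j := by
  choose c hc using exists_forall_eq_add_real hol maps diag hT periodic
  have hfd : ∀ y : ℝ, 0 < y → HasDerivAt (fun s : ℂ => f (fun j => s * x j + y * I))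
      (fderiv ℂ f (fun _ => y * I) (fun j => (x j : ℂ))) 0 := by
    intro y hy
    have hmem : (fun _ : Fin n => y * I) ∈ upperHalfPlanePow n := fun j => by simpa using hy
    have h1 : HasFDerivAt f (fderiv ℂ f (fun _ => y * I))
        ((fun (s : ℂ) (j : Fin n) => s * x j + y * I) 0) := by
      simpa using (hol.differentiableAt ((isOpen_upperHalfPlanePow n).mem_nhds hmem)).hasFDerivAt
    refine h1.comp_hasDerivAt (0 : ℂ) (hasDerivAt_pi.mpr fun j => ?_)
    simpa using ((hasDerivAt_id (0 : ℂ)).mul_const (x j : ℂ)).add_const ((y : ℂ) * I)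
  -- For real `s` the increment `c (s x)` does not involve `y`, so neither does the derivative.
  have hreal : ∀ y : ℝ, 0 < y → HasDerivAt (fun s : ℝ => (c (fun j => s * x j) : ℂ))
      (fderiv ℂ f (fun _ => y * I) (fun j => (x j : ℂ))) 0 := by
    intro y hy
    have h1 := (((hfd y hy).sub_const (y * I)).comp_ofReal (z := 0))
    refine h1.congr_of_eventuallyEq (Eventually.of_forall fun s => ?_)
    have := hc (fun j => s * x j) (y * I) (by simpa using hy)
    push_cast at this
    simp [this]
  have hderiv : ∀ y : ℝ, 0 < y → deriv (fun s : ℂ => f (fun j => s * x j + y * I)) 0 =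
      ∑ j, complexPartialDeriv f j (fun _ => I) * x j := by
    intro y hy
    have hmem : (fun _ : Fin n => I) ∈ upperHalfPlanePow n := fun j => by simp
    rw [(hfd y hy).deriv, (hreal y hy).unique (hreal 1 one_pos),
      ← fderiv_apply_eq_sum_complexPartialDeriv
        (hol.differentiableAt ((isOpen_upperHalfPlanePow n).mem_nhds hmem))]
    simp
  rw [hc x w hw]
  congr 1
  set R := ∑ j, |x j| + 1 with hR
  have hR0 : 0 < R := by positivity
  have hxR : ∀ j, |x j| ≤ R := fun j => by
    have := Finset.single_le_sum (f := fun j => |x j|) (fun j _ => abs_nonneg _)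
      (Finset.mem_univ j)
    linarith
  have hlim : Tendsto (fun y : ℝ => 8 * R ^ 2 / y) atTop (𝓝 0) :=
    tendsto_const_nhds.div_atTop tendsto_id
  rw [← sub_eq_zero, ← norm_le_zero_iff]
  refine ge_of_tendsto hlim ?_
  filter_upwards [eventually_gt_atTop (2 * R)] with y hy
  have hy0 : 0 < y := by linarith
  have := norm_sub_deriv_le hol maps diag hR0 hxR hy
  rwa [hderiv y hy0, hc x (y * I) (by simpa using hy0), add_sub_cancel_left] at this

lemma exists_pos_forall_lt_im {z : Fin n → ℂ} (hz : z ∈ upperHalfPlanePow n) :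
    ∃ m : ℝ, 0 < m ∧ ∀ j, m < (z j).im := by
  have h : ∀ᶠ m : ℝ in 𝓝[>] 0, ∀ j, m < (z j).im :=
    eventually_all.mpr fun j => (eventually_lt_nhds (hz j)).filter_mono nhdsWithin_le_nhds
  obtain ⟨m, h1, h2⟩ := (h.and self_mem_nhdsWithin).exists
  exact ⟨m, h2, h1⟩

end

theorem corollary4p3 (n : ℕ) (f : (Fin n → ℂ) → ℂ)
    (hol : DifferentiableOn ℂ f (upperHalfPlanePow n))
    (maps : ∀ z ∈ upperHalfPlanePow n, 0 < (f z).im)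
    (diag : ∀ w : ℂ, 0 < w.im → f (fun _ => w) = w)
    (T : ℝ) (hT : 0 < T)
    (periodic : ∀ z ∈ upperHalfPlanePow n, f (fun j => z j + (T : ℂ)) = f z + (T : ℂ)) :
    ∀ z ∈ upperHalfPlanePow n,
      f z = ∑ j : Fin n, complexPartialDeriv f j (fun _ => Complex.I) * z j := by
  intro z hz
  set α : Fin n → ℂ := fun j => complexPartialDeriv f j (fun _ => Complex.I) with hα
  have hmemI : (fun _ : Fin n => I) ∈ upperHalfPlanePow n := fun j => by simp
  have hsum : ∑ j, α j = 1 := by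
    have h1 := eq_add_sum_complexPartialDeriv hol maps diag hT periodic (fun _ => 1) (w := I)
      (by simp)
    have h2 := diag (1 + I) (by simp)
    simp only [ofReal_one, mul_one, h2] at h1
    rw [add_comm] at h1
    exact (add_left_cancel h1).symm
  obtain ⟨m, hm, hmz⟩ := exists_pos_forall_lt_im hz
  -- Real `s` gives real translates of the diagonal point of height `m`, and `p I = z`.
  set p : ℂ → Fin n → ℂ := fun s j => (z j).re + m * I + s * ((z j).im - m : ℝ) with hp
  have hpd : Differentiable ℂ p := by
    rw [differentiable_pi]
    intro j
    simp only [hp]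
    fun_prop
  have him : ∀ s j, (p s j).im = m + s.im * ((z j).im - m) := by
    intro s j
    simp [hp, -ofReal_sub]
  set U := p ⁻¹' upperHalfPlanePow n with hU
  have hUo : IsOpen U := (isOpen_upperHalfPlanePow n).preimage hpd.continuous
  have hUc : Convex ℝ U := by
    intro s hs t ht a b ha hb hab j
    have h1 : 0 < m + s.im * ((z j).im - m) := him s j ▸ hs j
    have h2 : 0 < m + t.im * ((z j).im - m) := him t j ▸ ht j
    have h3 : (p (a • s + b • t) j).im =
        a * (m + s.im * ((z j).im - m)) + b * (m + t.im * ((z j).im - m)) := by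
      rw [him]
      simp only [add_im, smul_im, smul_eq_mul]
      linear_combination (-m) * hab
    rw [h3]
    rcases ha.eq_or_lt with rfl | ha
    · have : b = 1 := by linarith
      simpa [this] using h2
    · exact add_pos_of_pos_of_nonneg (mul_pos ha h1) (mul_nonneg hb h2.le)
  have h0U : (0 : ℂ) ∈ U := fun j => by
    rw [him]
    simpa using hm
  have hIU : I ∈ U := fun j => by
    rw [him]
    simpa using hz j
  have hpI : p I = z := by
    ext j
    apply Complex.ext <;> simp [hp, -ofReal_sub]
  have hF : AnalyticOnNhd ℂ (fun s => f (p s)) U :=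
    (hol.comp hpd.differentiableOn (mapsTo_preimage _ _)).analyticOnNhd hUo
  have hG : AnalyticOnNhd ℂ (fun s => ∑ j, α j * p s j) U := by
    refine DifferentiableOn.analyticOnNhd (Differentiable.differentiableOn ?_) hUo
    have : ∀ j, Differentiable ℂ fun s => p s j := differentiable_pi.mp hpd
    fun_prop
  have hreal : ∀ s : ℝ, f (p s) = ∑ j, α j * p s j := by
    intro s
    have h1 := eq_add_sum_complexPartialDeriv hol maps diag hT periodic
      (fun j => (z j).re + s * ((z j).im - m)) (w := m * I) (by simpa using hm)
    have h2 : p s = fun j => (((z j).re + s * ((z j).im - m) : ℝ) : ℂ) + m * I := by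
      ext j
      simp only [hp]
      push_cast
      ring
    rw [h2, h1]
    simp only [mul_add, Finset.sum_add_distrib, ← Finset.sum_mul, hsum, one_mul]
    rw [add_comm]
  have hfreq : ∃ᶠ s in 𝓝[≠] (0 : ℂ), f (p s) = ∑ j, α j * p s j := by
    have ht : Tendsto (fun s : ℝ => (s : ℂ)) (𝓝[≠] 0) (𝓝[≠] 0) := by
      refine tendsto_nhdsWithin_of_tendsto_nhds_of_eventually_within _ ?_ ?_
      · exact (continuous_ofReal.tendsto' 0 0 (by simp)).mono_left nhdsWithin_le_nhds
      · filter_upwards [self_mem_nhdsWithin] with s hs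
        simpa using hs
    exact ht.frequently (Eventually.of_forall hreal).frequently
  have := hF.eqOn_of_preconnected_of_frequently_eq hG hUc.isPreconnected h0U hfreq hIU
  simpa only [hpI] using this
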